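/- Let $\alpha,\beta,\gamma$ be the convex cones of all $A$-$BC$, $B$-$CA$ and $C$-$AB$ separable unnormalized three-qubit states, respectively; that is, $\alpha$ is the set of all finite sums $\sum_k |v_k\rangle\langle v_k|$ in $M_2(\mathbb C)\otimes M_2(\mathbb C)\otimes M_2(\mathbb C)$ with product vectors $v_k=x_k\otimes y_k$, $x_k\in\mathbb C^2_A$, $y_k\in\mathbb C^2_B\otimes\mathbb C^2_C$, and $\beta,\gamma$ are defined in the same way for the bipartitions $B$-$CA$ and $C$-$AB$. Let $\mathcal L$ be the lattice of convex cones generated by $\alpha,\beta,\gamma$ with respect to the operations $\sigma\wedge\tau=\sigma\cap\tau$ and $\sigma\vee\tau=\operatorname{conv}(\sigma\cup\tau)$. Then: 1. the least element of $\mathcal L$ is $\alpha\wedge\beta\wedge\gamma$ and its greatest element is $\alpha\vee\beta\vee\gamma$; 2. $\alpha\wedge\beta\wedge\gamma\subsetneq\alpha\wedge(\beta\vee\gamma)$; 3. $\alpha$ has no complement in $\mathcal L$: there is no $\sigma\in\mathcal L$ with $\alpha\wedge\sigma=\alpha\wedge\beta\wedge\gamma$ and $\alpha\vee\sigma=\alpha\vee\beta\vee\gamma$.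 In particular, the lattice $\mathcal L$ is not complemented. -/

import Mathlib

namespace ThreeQubit

/-- Lexicographically ordered index set of the standard basis of `ℂ² ⊗ ℂ² ⊗ ℂ²`
(subsystems `A`, `B`, `C`, in this order). -/
abbrev Idx : Type := Fin 2 × Fin 2 × Fin 2

/-- `8 × 8` complex matrices, that is, `M₂ ⊗ M₂ ⊗ M₂`. -/
abbrev Mat : Type := Matrix Idx Idx ℂ

/-- The unnormalized pure state `|v⟩⟨v|`. -/
def pure (v : Idx → ℂ) : Mat := Matrix.vecMulVec v (star v)

/-- The vector `x ⊗ y`, with `x` in the space of `A` and `y` in the space of `BC`. -/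
def prodA (x : Fin 2 → ℂ) (y : Fin 2 × Fin 2 → ℂ) : Idx → ℂ :=
  fun i => x i.1 * y (i.2.1, i.2.2)

/-- The vector `x ⊗ y`, with `x` in the space of `B` and `y` in the space of `CA`. -/
def prodB (x : Fin 2 → ℂ) (y : Fin 2 × Fin 2 → ℂ) : Idx → ℂ :=
  fun i => x i.2.1 * y (i.2.2, i.1)

/-- The vector `x ⊗ y`, with `x` in the space of `C` and `y` in the space of `AB`. -/
def prodC (x : Fin 2 → ℂ) (y : Fin 2 × Fin 2 → ℂ) : Idx → ℂ :=
  fun i => x i.2.2 * y (i.1, i.2.1)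

/-- The convex cone of `A`-`BC` separable unnormalized states: finite sums, with nonnegative
coefficients, of pure product states for the bipartition `A`-`BC`. -/
noncomputable def coneA : PointedCone ℝ Mat :=
  PointedCone.hull ℝ {ρ | ∃ x y, ρ = pure (prodA x y)}

/-- The convex cone of `B`-`CA` separable unnormalized states. -/
noncomputable def coneB : PointedCone ℝ Mat :=
  PointedCone.hull ℝ {ρ | ∃ x y, ρ = pure (prodB x y)}

/-- The convex cone of `C`-`AB` separable unnormalized states. -/
noncomputable def coneC : PointedCone ℝ Mat :=
  PointedCone.hull ℝ {ρ | ∃ x y, ρ = pure (prodC x y)}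

/-- In the lattice of convex cones (containing `0`), the meet is the intersection. -/
theorem coe_inf (σ τ : PointedCone ℝ Mat) :
    ((σ ⊓ τ : PointedCone ℝ Mat) : Set Mat) = (σ : Set Mat) ∩ (τ : Set Mat) := rfl

/-- In the lattice of convex cones (containing `0`), the join is the convex hull of the union. -/
theorem coe_sup (σ τ : PointedCone ℝ Mat) :
    ((σ ⊔ τ : PointedCone ℝ Mat) : Set Mat) = convexHull ℝ ((σ : Set Mat) ∪ (τ : Set Mat)) := by
  apply Set.Subset.antisymm
  · intro x hx
    obtain ⟨a, ha, b, hb, rfl⟩ := Submodule.mem_sup.1 hx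
    have ha' : (2 : ℝ) • a ∈ convexHull ℝ ((σ : Set Mat) ∪ (τ : Set Mat)) :=
      subset_convexHull ℝ _ (Or.inl (σ.smul_mem (by norm_num : (0 : ℝ) ≤ 2) ha))
    have hb' : (2 : ℝ) • b ∈ convexHull ℝ ((σ : Set Mat) ∪ (τ : Set Mat)) :=
      subset_convexHull ℝ _ (Or.inr (τ.smul_mem (by norm_num : (0 : ℝ) ≤ 2) hb))
    have h := (convex_convexHull ℝ ((σ : Set Mat) ∪ (τ : Set Mat))) ha' hb'
      (a := 1 / 2) (b := 1 / 2) (by norm_num) (by norm_num) (by norm_num)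
    simpa [smul_smul] using h
  · refine convexHull_min (Set.union_subset ?_ ?_) (PointedCone.toConvexCone (σ ⊔ τ)).convex
    · exact fun x hx => (le_sup_left : σ ≤ σ ⊔ τ) hx
    · exact fun x hx => (le_sup_right : τ ≤ σ ⊔ τ) hx

/-- The lattice generated by the three cones with respect to convex hull and intersection. -/
noncomputable def lat : Sublattice (PointedCone ℝ Mat) :=
  Sublattice.ofIsSublattice (latticeClosure {coneA, coneB, coneC}) isSublattice_latticeClosure

theorem coneA_mem : coneA ∈ lat := subset_latticeClosure (by simp)

theorem coneB_mem : coneB ∈ lat := subset_latticeClosure (by simp)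

theorem coneC_mem : coneC ∈ lat := subset_latticeClosure (by simp)

theorem le_of_mem_lat {σ : PointedCone ℝ Mat} (h : σ ∈ lat) :
    coneA ⊓ coneB ⊓ coneC ≤ σ ∧ σ ≤ coneA ⊔ coneB ⊔ coneC := by
  have hs : IsSublattice (Set.Icc (coneA ⊓ coneB ⊓ coneC) (coneA ⊔ coneB ⊔ coneC)) :=
    ⟨fun _ ha _ hb => ⟨ha.1.trans le_sup_left, sup_le ha.2 hb.2⟩,
      fun _ ha _ hb => ⟨le_inf ha.1 hb.1, inf_le_left.trans ha.2⟩⟩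
  refine latticeClosure_min (t := Set.Icc _ _) ?_ hs h
  rintro τ (rfl | rfl | rfl)
  · exact ⟨inf_le_left.trans inf_le_left, le_sup_left.trans le_sup_left⟩
  · exact ⟨inf_le_left.trans inf_le_right, le_sup_right.trans le_sup_left⟩
  · exact ⟨inf_le_right, le_sup_right⟩

/-- The least and the greatest element of the generated lattice. -/
noncomputable instance : BoundedOrder lat where
  bot := ⟨coneA ⊓ coneB ⊓ coneC,
    lat.infClosed (lat.infClosed coneA_mem coneB_mem) coneC_mem⟩
  bot_le σ := (le_of_mem_lat σ.2).1
  top := ⟨coneA ⊔ coneB ⊔ coneC,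
    lat.supClosed (lat.supClosed coneA_mem coneB_mem) coneC_mem⟩
  le_top σ := (le_of_mem_lat σ.2).2

/-- The cone of `A`-`BC` separable unnormalized states, as an element of the lattice. -/
noncomputable def latA : lat := ⟨coneA, coneA_mem⟩

end ThreeQubit

namespace ThreeQubit

open Matrix ComplexConjugate
open scoped ComplexOrder

/-! Pure states span extreme rays of the positive semidefinite cone, so a pure state in a join of
two cones of positive semidefinite matrices lies in one of them (`pure_mem_of_pure_mem_sup`). Let
`σ` be a complement of `α`. A pure product state for `B`-`CA` or `C`-`AB` then lies in `α` or in
`σ`. In the first case its vector splits across two cuts, hence fully, so the state lies in `α ∧ β ∧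
γ ≤ σ` anyway. Thus `β ∨ γ ≤ σ`, and `α ∧ (β ∨ γ) ≤ α ∧ σ = α ∧ β ∧ γ`. This contradicts part 2,
where an explicit state of `α ∧ (β ∨ γ)` fails the partial transposition test for `B`. -/

/-- The partial transposition test on the four basis vectors `e a k`. -/
noncomputable def pptForm (e : Fin 2 → Fin 2 → Idx) (w : Fin 2 → Fin 2 → ℂ) (M : Mat) : ℝ :=
  (∑ a, ∑ k, ∑ a', ∑ k', conj (w a k) * M (e a' k) (e a k') * w a' k').re

theorem pptForm_add (e : Fin 2 → Fin 2 → Idx) (w : Fin 2 → Fin 2 → ℂ) (M N : Mat) :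
    pptForm e w (M + N) = pptForm e w M + pptForm e w N := by
  simp only [pptForm, Matrix.add_apply, mul_add, add_mul, Finset.sum_add_distrib, Complex.add_re]

theorem pptForm_smul (e : Fin 2 → Fin 2 → Idx) (w : Fin 2 → Fin 2 → ℂ) (c : ℝ) (M : Mat) :
    pptForm e w (c • M) = c * pptForm e w M := by
  have h : ∀ x y z : ℂ, x * (c • y) * z = (c : ℂ) * (x * y * z) := fun x y z => by
    rw [Complex.real_smul]; ring
  simp only [pptForm, Matrix.smul_apply, h, ← Finset.mul_sum, Complex.re_ofReal_mul]

/-- On a product vector the form is the perfect square `|∑ w a k * u a * conj (t k)|²`. -/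
theorem pptForm_pure_nonneg (e : Fin 2 → Fin 2 → Idx) (w : Fin 2 → Fin 2 → ℂ) (v : Idx → ℂ)
    (u t : Fin 2 → ℂ) (h : ∀ a k, v (e a k) = u a * t k) : 0 ≤ pptForm e w (pure v) := by
  have key : (∑ a, ∑ k, ∑ a', ∑ k', conj (w a k) * pure v (e a' k) (e a k') * w a' k')
      = conj (∑ a, ∑ k, w a k * u a * conj (t k)) * (∑ a, ∑ k, w a k * u a * conj (t k)) := by
    simp only [pure, vecMulVec_apply, Pi.star_apply, h, Fin.sum_univ_two, RCLike.star_def,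
      map_add, map_mul, Complex.conj_conj]
    ring
  rw [pptForm, key, ← Complex.normSq_eq_conj_mul_self, Complex.ofReal_re]
  exact Complex.normSq_nonneg _

theorem nonneg_of_mem_hull {S : Set Mat} (f : Mat → ℝ) (hadd : ∀ M N, f (M + N) = f M + f N)
    (hsmul : ∀ (c : ℝ) M, f (c • M) = c * f M) (hS : ∀ M ∈ S, 0 ≤ f M) {M : Mat}
    (hM : M ∈ PointedCone.hull ℝ S) : 0 ≤ f M := by
  induction hM using Submodule.span_induction with
  | mem x hx => exact hS x hx
  | zero => have h := hsmul 0 0; rw [zero_smul, zero_mul] at h; exact h.ge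
  | add x y _ _ hx hy => rw [hadd]; exact add_nonneg hx hy
  | smul c x _ hx =>
    have h : f (c • x) = c * f x := hsmul c x
    rw [h]
    exact mul_nonneg c.2 hx

theorem pptForm_nonneg_of_mem_coneA {M : Mat} (hM : M ∈ coneA) (e : Fin 2 → Fin 2 → Idx)
    (g : Fin 2 → Fin 2 × Fin 2) (he : ∀ a k, e a k = (a, g k)) (w : Fin 2 → Fin 2 → ℂ) :
    0 ≤ pptForm e w M := by
  refine nonneg_of_mem_hull _ (pptForm_add e w) (pptForm_smul e w) ?_ hM
  rintro _ ⟨x, y, rfl⟩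
  exact pptForm_pure_nonneg e w _ x (fun k => y (g k)) fun a k => by simp [prodA, he]

theorem pptForm_nonneg_of_mem_coneB {M : Mat} (hM : M ∈ coneB) (e : Fin 2 → Fin 2 → Idx)
    (g : Fin 2 → Fin 2 × Fin 2) (he : ∀ b k, e b k = ((g k).1, b, (g k).2))
    (w : Fin 2 → Fin 2 → ℂ) : 0 ≤ pptForm e w M := by
  refine nonneg_of_mem_hull _ (pptForm_add e w) (pptForm_smul e w) ?_ hM
  rintro _ ⟨x, y, rfl⟩
  exact pptForm_pure_nonneg e w _ x (fun k => y ((g k).2, (g k).1)) fun a k => by simp [prodB, he]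

/-! ### Pure states separable across two cuts -/

/-- A pure state that passes the partial transposition test has vanishing minors across the cut. -/
theorem minor_eq_of_pure_mem_coneA {v : Idx → ℂ} (hv : pure v ∈ coneA)
    (g : Fin 2 → Fin 2 × Fin 2) :
    v (0, g 0) * v (1, g 1) = v (1, g 0) * v (0, g 1) := by
  set d := v (0, g 0) * v (1, g 1) - v (1, g 0) * v (0, g 1) with hd
  have h := pptForm_nonneg_of_mem_coneA hv (fun a k => (a, g k)) g (fun _ _ => rfl)
    -- For this `w` the form takes the value `-2|d|²`, so nonnegativity forces `d = 0`.
    !![v (1, g 0), v (1, g 1); -v (0, g 0), -v (0, g 1)]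
  have key : pptForm (fun a k => (a, g k)) !![v (1, g 0), v (1, g 1); -v (0, g 0), -v (0, g 1)]
      (pure v) = (-2 * (conj d * d)).re := by
    rw [hd]
    unfold pptForm
    congr 1
    simp only [pure, vecMulVec_apply, Pi.star_apply, Fin.sum_univ_two, RCLike.star_def,
      map_mul, map_sub, map_neg, of_apply, cons_val_zero, cons_val_one, cons_val', cons_val_fin_one]
    ring
  rw [key, ← Complex.normSq_eq_conj_mul_self] at h
  have h0 : Complex.normSq d = 0 := by
    have := Complex.normSq_nonneg d
    simp at h
    linarith
  exact sub_eq_zero.1 (Complex.normSq_eq_zero.1 h0)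

theorem exists_eq_mul_of_minor_eq {y : Fin 2 → Fin 2 → ℂ}
    (h : y 0 0 * y 1 1 = y 1 0 * y 0 1) : ∃ p q : Fin 2 → ℂ, ∀ i j, y i j = p i * q j := by
  by_cases h0 : ∃ j, y 0 j ≠ 0
  · obtain ⟨j, hj⟩ := h0
    refine ⟨fun i => y i j / y 0 j, y 0, ?_⟩
    intro i k
    rw [div_mul_eq_mul_div, eq_div_iff hj]
    fin_cases i <;> fin_cases j <;> fin_cases k <;> simp at * <;> grind
  · push Not at h0
    refine ⟨![0, 1], y 1, fun i k => ?_⟩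
    fin_cases i <;> simp [h0]

theorem pure_prodA_mem (x : Fin 2 → ℂ) (y : Fin 2 × Fin 2 → ℂ) : pure (prodA x y) ∈ coneA :=
  Submodule.subset_span ⟨x, y, rfl⟩

theorem pure_prodB_mem (x : Fin 2 → ℂ) (y : Fin 2 × Fin 2 → ℂ) : pure (prodB x y) ∈ coneB :=
  Submodule.subset_span ⟨x, y, rfl⟩

theorem pure_prodC_mem (x : Fin 2 → ℂ) (y : Fin 2 × Fin 2 → ℂ) : pure (prodC x y) ∈ coneC :=
  Submodule.subset_span ⟨x, y, rfl⟩

/-- Fixing a `B` index where `x` is nonzero, the `A`-minor of the vector is that of `y` times `x i ^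
2`. Hence `y` splits and the vector is fully product. -/
theorem pure_prodB_mem_coneC {x : Fin 2 → ℂ} {y : Fin 2 × Fin 2 → ℂ}
    (h : pure (prodB x y) ∈ coneA) : pure (prodB x y) ∈ coneC := by
  by_cases hx : ∃ i, x i ≠ 0
  · obtain ⟨i, hi⟩ := hx
    have hm := minor_eq_of_pure_mem_coneA h fun k => (i, k)
    simp only [prodB] at hm
    obtain ⟨p, q, hpq⟩ := exists_eq_mul_of_minor_eq (y := fun c a => y (c, a))
      (mul_left_cancel₀ (mul_ne_zero hi hi) (by linear_combination hm))
    have : prodB x y = prodC p (fun k => q k.1 * x k.2) := by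
      funext j
      simp only [prodB, prodC]
      rw [hpq]
      ring
    rw [this]
    exact pure_prodC_mem _ _
  · push Not at hx
    have : prodB x y = prodC 0 0 := by funext j; simp [prodB, prodC, hx]
    rw [this]
    exact pure_prodC_mem _ _

theorem pure_prodC_mem_coneB {x : Fin 2 → ℂ} {y : Fin 2 × Fin 2 → ℂ}
    (h : pure (prodC x y) ∈ coneA) : pure (prodC x y) ∈ coneB := by
  by_cases hx : ∃ i, x i ≠ 0
  · obtain ⟨i, hi⟩ := hx
    have hm := minor_eq_of_pure_mem_coneA h fun k => (k, i)
    simp only [prodC] at hm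
    obtain ⟨p, q, hpq⟩ := exists_eq_mul_of_minor_eq (y := fun a b => y (a, b))
      (mul_left_cancel₀ (mul_ne_zero hi hi) (by linear_combination hm))
    have : prodC x y = prodB q (fun k => x k.1 * p k.2) := by
      funext j
      simp only [prodB, prodC]
      rw [hpq]
      ring
    rw [this]
    exact pure_prodB_mem _ _
  · push Not at hx
    have : prodC x y = prodB 0 0 := by funext j; simp [prodB, prodC, hx]
    rw [this]
    exact pure_prodB_mem _ _

/-! ### Extremality of pure states -/

theorem posSemidef_of_mem_hull {S : Set Mat} (hS : ∀ M ∈ S, M.PosSemidef) {M : Mat}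
    (hM : M ∈ PointedCone.hull ℝ S) : M.PosSemidef := by
  induction hM using Submodule.span_induction with
  | mem x hx => exact hS x hx
  | zero => exact PosSemidef.zero
  | add x y _ _ hx hy => exact hx.add hy
  | smul c x _ hx => exact hx.smul (show (0 : ℝ) ≤ c from c.2)

theorem posSemidef_of_mem_sup {M : Mat} (hM : M ∈ coneA ⊔ coneB ⊔ coneC) : M.PosSemidef := by
  obtain ⟨ab, hab, c, hc, rfl⟩ := Submodule.mem_sup.1 hM
  obtain ⟨a, ha, b, hb, rfl⟩ := Submodule.mem_sup.1 hab
  refine ((posSemidef_of_mem_hull ?_ ha).add (posSemidef_of_mem_hull ?_ hb)).add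
    (posSemidef_of_mem_hull ?_ hc) <;>
  · rintro _ ⟨x, y, rfl⟩
    exact posSemidef_vecMulVec_self_star _

/-- Pure states span extreme rays of the cone of positive semidefinite matrices. -/
theorem eq_smul_pure_of_add_eq_pure {P Q : Mat} (hP : P.PosSemidef) (hQ : Q.PosSemidef)
    {v : Idx → ℂ} (h : P + Q = pure v) : ∃ c : ℝ, 0 ≤ c ∧ P = c • pure v := by
  -- The quadratic forms of `P` and `Q` at such a `w` are nonnegative with sum zero, so both vanish.
  have hker : ∀ w, star v ⬝ᵥ w = 0 → P *ᵥ w = 0 := by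
    intro w hw
    rw [← hP.dotProduct_mulVec_zero_iff]
    have h1 : star w ⬝ᵥ (P + Q) *ᵥ w = 0 := by
      rw [h, pure, vecMulVec_mulVec, hw]
      simp
    rw [add_mulVec, dotProduct_add] at h1
    exact ((add_eq_zero_iff_of_nonneg (hP.dotProduct_mulVec_nonneg w)
      (hQ.dotProduct_mulVec_nonneg w)).1 h1).1
  by_cases hv : v = 0
  · refine ⟨0, le_rfl, ?_⟩
    ext i j
    have := congrFun (hker (Pi.single j 1) (by simp [hv])) i
    simpa using this
  set N := star v ⬝ᵥ v with hN
  have hN0 : N ≠ 0 := fun h0 => hv (dotProduct_star_self_eq_zero.1 h0)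
  have hcol : ∀ i j, N * P i j = (P *ᵥ v) i * star (v j) := by
    intro i j
    -- This is `N` times the projection of the basis vector `j` onto the orthogonal complement of
    -- `v`.
    have h1 := congrFun (hker (N • Pi.single j 1 - star (v j) • v) (by
      rw [dotProduct_sub, dotProduct_smul, dotProduct_smul]
      simp [hN, mul_comm])) i
    simp [mulVec_sub, mulVec_smul] at h1
    simp
    linear_combination h1
  have hNreal : star N = N := (star_dotProduct v v).symm
  have hrow : ∀ i, N * (P *ᵥ v) i = (star v ⬝ᵥ P *ᵥ v) * v i := by
    intro i
    have h1 : ∀ j, N * P i j = star ((P *ᵥ v) j) * v i := fun j => by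
      have h2 := congrArg star (hcol j i)
      rwa [star_mul', hNreal, hP.1.apply, star_mul', star_star] at h2
    have hs : star v ⬝ᵥ P *ᵥ v = star (P *ᵥ v) ⬝ᵥ v := by
      rw [star_mulVec, hP.1.eq, ← dotProduct_mulVec]
    rw [hs, mulVec, dotProduct, Finset.mul_sum, dotProduct, Finset.sum_mul]
    refine Finset.sum_congr rfl fun j _ => ?_
    rw [← mul_assoc, h1 j]
    simp only [Pi.star_apply]
    ring
  have hre : ∀ z : ℂ, 0 ≤ z → ((z.re : ℝ) : ℂ) = z := fun z hz =>
    Complex.ext rfl (Complex.nonneg_iff.1 hz).2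
  have hq := hP.dotProduct_mulVec_nonneg v
  have hNn : 0 ≤ N := dotProduct_star_self_nonneg v
  refine ⟨(star v ⬝ᵥ P *ᵥ v).re / N.re ^ 2,
    div_nonneg (Complex.nonneg_iff.1 hq).1 (sq_nonneg _), ?_⟩
  ext i j
  rw [Matrix.smul_apply, Complex.real_smul, Complex.ofReal_div, Complex.ofReal_pow, hre _ hq,
    hre _ hNn, pure, vecMulVec_apply, Pi.star_apply, div_mul_eq_mul_div, eq_div_iff (by simp [hN0])]
  linear_combination N * hcol i j + star (v j) * hrow i

theorem pure_mem_of_pure_mem_sup {σ τ : PointedCone ℝ Mat} (hσ : ∀ M ∈ σ, M.PosSemidef)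
    (hτ : ∀ M ∈ τ, M.PosSemidef) {v : Idx → ℂ} (hv : pure v ∈ σ ⊔ τ) :
    pure v ∈ σ ∨ pure v ∈ τ := by
  obtain ⟨s, hs, t, ht, hst⟩ := Submodule.mem_sup.1 hv
  obtain ⟨c, hc, rfl⟩ := eq_smul_pure_of_add_eq_pure (hσ s hs) (hτ t ht) hst
  rcases hc.eq_or_lt with rfl | hc
  · right
    rw [zero_smul, zero_add] at hst
    rwa [← hst]
  · left
    have := σ.smul_mem (inv_nonneg.2 hc.le) hs
    rwa [smul_smul, inv_mul_cancel₀ hc.ne', one_smul] at this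

/-! ### A state of `α ∧ (β ∨ γ)` outside `β` -/

/-- The state `∑ₛ |aₛ⟩⟨aₛ| + 4 |010⟩⟨010| + 4 |101⟩⟨101|` with
`aₛ = (|0⟩ + s|1⟩) ⊗ (|00⟩ + s|11⟩)` and `s = ±1`. -/
noncomputable def biseparableWitness : Mat :=
  pure (prodA ![1, 1] fun k => !![1, 0; 0, 1] k.1 k.2) +
  pure (prodA ![1, -1] fun k => !![1, 0; 0, -1] k.1 k.2) +
  pure (prodA ![2, 0] fun k => !![0, 0; 1, 0] k.1 k.2) +
  pure (prodA ![0, 2] fun k => !![0, 1; 0, 0] k.1 k.2)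

/-- The `B` and `C` terms contribute opposite coherences between `|010⟩` and `|101⟩`. These cancel
and leave the diagonal terms. -/
theorem biseparableWitness_eq : biseparableWitness =
    (pure (prodB ![1, 1] fun k => !![1, 0; 0, 1] k.1 k.2) +
      pure (prodB ![1, -1] fun k => !![1, 0; 0, -1] k.1 k.2)) +
    (pure (prodC ![1, Complex.I] fun k => !![0, 1; Complex.I, 0] k.1 k.2) +
      pure (prodC ![1, -Complex.I] fun k => !![0, 1; -Complex.I, 0] k.1 k.2)) := by
  ext ⟨a, b, c⟩ ⟨a', b', c'⟩
  fin_cases a <;> fin_cases b <;> fin_cases c <;> fin_cases a' <;> fin_cases b' <;>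
    fin_cases c' <;>
    simp [biseparableWitness, pure, prodA, prodB, prodC, vecMulVec_apply] <;> norm_num

theorem biseparableWitness_mem_coneA : biseparableWitness ∈ coneA :=
  add_mem (add_mem (add_mem (pure_prodA_mem _ _) (pure_prodA_mem _ _)) (pure_prodA_mem _ _))
    (pure_prodA_mem _ _)

theorem biseparableWitness_mem_sup : biseparableWitness ∈ coneB ⊔ coneC := by
  rw [biseparableWitness_eq]
  exact Submodule.add_mem_sup (add_mem (pure_prodB_mem _ _) (pure_prodB_mem _ _))
    (add_mem (pure_prodC_mem _ _) (pure_prodC_mem _ _))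

theorem biseparableWitness_notMem_coneB : biseparableWitness ∉ coneB := by
  intro h
  -- The test vector is `|001⟩ - |110⟩`. Both diagonal entries there vanish, while the coherence
  -- between `|011⟩` and `|100⟩`, moved there by transposing `B`, is `2`; the value is `-4`.
  have h1 := pptForm_nonneg_of_mem_coneB h (fun b k => (![0, 1] k, b, ![1, 0] k))
    (fun k => (![0, 1] k, ![1, 0] k)) (fun _ _ => rfl) !![1, 0; 0, -1]
  simp [pptForm, biseparableWitness, pure, prodA, vecMulVec_apply] at h1
  norm_num at h1

theorem inf_lt_inf_sup : coneA ⊓ coneB ⊓ coneC < coneA ⊓ (coneB ⊔ coneC) := by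
  refine lt_of_le_of_ne (le_inf (inf_le_left.trans inf_le_left) (inf_le_right.trans le_sup_right))
    fun h => biseparableWitness_notMem_coneB ?_
  have hm : biseparableWitness ∈ coneA ⊓ (coneB ⊔ coneC) :=
    ⟨biseparableWitness_mem_coneA, biseparableWitness_mem_sup⟩
  rw [← h] at hm
  exact hm.1.2

/-! ### Absence of a complement -/

theorem not_isCompl_latA (σ : lat) : ¬ IsCompl latA σ := by
  intro hc
  have hsup : coneA ⊔ (σ : PointedCone ℝ Mat) = coneA ⊔ coneB ⊔ coneC :=
    congrArg Subtype.val hc.sup_eq_top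
  have hinf : coneA ⊓ (σ : PointedCone ℝ Mat) = coneA ⊓ coneB ⊓ coneC :=
    congrArg Subtype.val hc.inf_eq_bot
  have hbot : coneA ⊓ coneB ⊓ coneC ≤ σ := (le_of_mem_lat σ.2).1
  have hmem : ∀ v, pure v ∈ coneA ⊔ coneB ⊔ coneC → pure v ∈ coneA ∨ pure v ∈ σ.1 := fun v hv =>
    pure_mem_of_pure_mem_sup
      (fun M hM => posSemidef_of_mem_sup (le_sup_left.trans_eq hsup hM))
      (fun M hM => posSemidef_of_mem_sup (le_sup_right.trans_eq hsup hM)) (hsup ▸ hv)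
  have hB : coneB ≤ σ := by
    refine Submodule.span_le.2 ?_
    rintro _ ⟨x, y, rfl⟩
    have hb := pure_prodB_mem x y
    exact (hmem _ ((le_sup_right.trans le_sup_left : coneB ≤ _) hb)).elim
      (fun ha => hbot ⟨⟨ha, hb⟩, pure_prodB_mem_coneC ha⟩) id
  have hC : coneC ≤ σ := by
    refine Submodule.span_le.2 ?_
    rintro _ ⟨x, y, rfl⟩
    have hc := pure_prodC_mem x y
    exact (hmem _ ((le_sup_right : coneC ≤ _) hc)).elim
      (fun ha => hbot ⟨⟨ha, pure_prodC_mem_coneB ha⟩, hc⟩) id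
  exact inf_lt_inf_sup.not_ge ((inf_le_inf_left _ (sup_le hB hC)).trans_eq hinf)

end ThreeQubit

theorem mainTheorem7 :
    ((⊥ : ThreeQubit.lat) : PointedCone ℝ ThreeQubit.Mat)
        = ThreeQubit.coneA ⊓ ThreeQubit.coneB ⊓ ThreeQubit.coneC ∧
    ((⊤ : ThreeQubit.lat) : PointedCone ℝ ThreeQubit.Mat)
        = ThreeQubit.coneA ⊔ ThreeQubit.coneB ⊔ ThreeQubit.coneC ∧
    ThreeQubit.coneA ⊓ ThreeQubit.coneB ⊓ ThreeQubit.coneC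
        < ThreeQubit.coneA ⊓ (ThreeQubit.coneB ⊔ ThreeQubit.coneC) ∧
    (¬ ∃ σ : ThreeQubit.lat, IsCompl ThreeQubit.latA σ) ∧
    ¬ ComplementedLattice ThreeQubit.lat := by
  refine ⟨rfl, rfl, ThreeQubit.inf_lt_inf_sup,
    fun ⟨σ, h⟩ => ThreeQubit.not_isCompl_latA σ h, fun h => ?_⟩
  obtain ⟨σ, hσ⟩ := h.exists_isCompl ThreeQubit.latA
  exact ThreeQubit.not_isCompl_latA σ hσ
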